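/- Let $m\in\mathbb N$, let $Y\subset\mathbb R^m$ be a closed unbounded set, let $U_0$ be a compact metric space, let $U(\cdot)$ be an upper semicontinuous map that assigns to each $y\in Y$ a compact set $U(y)\subset U_0$, and let $f:\mathbb R^m\times U_0\to\mathbb R^m$ be continuous with $|f(y,u)|\to\infty$ as $|y|\to\infty$, uniformly in $u\in U_0$. Put $$G=\{(y,u):\ y\in Y,\ u\in U(y),\ f(y,u)\in Y\}.$$ For $y_0\in Y$ let $\mathcal U(y_0)$ be the set of controls $u(0),u(1),\dots$ in $U_0$ such that the trajectory defined by $y(0)=y_0$, $y(t+1)=f(y(t),u(t))$ satisfies $y(t)\in Y$ and $u(t)\in U(y(t))$ for all $t\ge 0$; for an integer $S\ge1$ let $\mathcal U_S(y_0)$ be the set of controls $u(0),\dots,u(S-1)$ in $U_0$ whose trajectory satisfies $(y(t),u(t))\in G$ for $t=0,\dots,S-1$. Assume that $\mathcal U(y_0)\neq\emptyset$ for every $y_0\in Y$. Let $g:\mathbb R^m\times U_0\to\mathbb R$ be continuous, and for $\alpha\in(0,1)$, $S\ge 1$ and $y_0\in Y$ set $$V_\alpha(y_0)=(1-\alpha)\inf_{u(\cdot)\in\mathcal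 U(y_0)}\sum_{t=0}^\infty\alpha^t g(y(t),u(t)),\qquad V(S,y_0)=\frac1S\inf_{u(\cdot)\in\mathcal U_S(y_0)}\sum_{t=0}^{S-1}g(y(t),u(t)).$$ Let $\bar Y=Y\cup\{\infty\}$ be the one-point compactification of $Y$, let $W$ be the set of Borel probability measures $\gamma$ on $G$ such that $$\int_G\bigl(\varphi(f(y,u))-\varphi(y)\bigr)\,d\gamma=0\quad\text{for all }\varphi\in C(\bar Y),$$ and let $g^*=\inf_{\gamma\in W}\int_G g\,d\gamma$, with $g^*=+\infty$ if $W=\emptyset$. If $g$ is bounded, then $$\text{(a)}\quad g^*\ \ge\ \limsup_{\alpha\to1^-}\ \inf_{y\in Y}V_\alpha(y),\qquad\qquad \text{(b)}\quad g^*\ \ge\ \limsup_{S\to\infty}\ \inf_{y\in Y}V(S,y).$$ -/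

import Mathlib

open Filter Topology MeasureTheory Bornology

noncomputable section

namespace ControlLP

variable {m : ℕ} {U₀ : Type*}

/-- The set `G` of all `(y, u)` with `y ∈ Y`, `u ∈ U(y)` and `f(y, u) ∈ Y`. -/
def G (Y : Set (EuclideanSpace ℝ (Fin m))) (U : EuclideanSpace ℝ (Fin m) → Set U₀)
    (f : EuclideanSpace ℝ (Fin m) × U₀ → EuclideanSpace ℝ (Fin m)) :
    Set (EuclideanSpace ℝ (Fin m) × U₀) :=
  {p | p.1 ∈ Y ∧ p.2 ∈ U p.1 ∧ f p ∈ Y}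

/-- The trajectory of `y(t+1) = f(y(t), u(t))`, `y(0) = y₀`, under the control `u`. -/
def trajectory (f : EuclideanSpace ℝ (Fin m) × U₀ → EuclideanSpace ℝ (Fin m))
    (y₀ : EuclideanSpace ℝ (Fin m)) (u : ℕ → U₀) : ℕ → EuclideanSpace ℝ (Fin m)
  | 0 => y₀
  | t + 1 => f (trajectory f y₀ u t, u t)

/-- Admissible controls on the infinite horizon with initial state `y₀`. -/
def admissibleControls (Y : Set (EuclideanSpace ℝ (Fin m)))
    (U : EuclideanSpace ℝ (Fin m) → Set U₀)
    (f : EuclideanSpace ℝ (Fin m) × U₀ → EuclideanSpace ℝ (Fin m))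
    (y₀ : EuclideanSpace ℝ (Fin m)) : Set (ℕ → U₀) :=
  {u | ∀ t, trajectory f y₀ u t ∈ Y ∧ u t ∈ U (trajectory f y₀ u t)}

/-- Admissible controls on the time sequence `{0, …, S-1}` with initial state `y₀`: the process
stays in `G` at the times `0, …, S-1`, so that `y(0), …, y(S)` all lie in `Y`. A control is written
as a sequence indexed by `ℕ`; its values at times `t ≥ S` are unconstrained and irrelevant. -/
def admissibleControlsUpTo (Y : Set (EuclideanSpace ℝ (Fin m)))
    (U : EuclideanSpace ℝ (Fin m) → Set U₀)
    (f : EuclideanSpace ℝ (Fin m) × U₀ → EuclideanSpace ℝ (Fin m))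
    (S : ℕ) (y₀ : EuclideanSpace ℝ (Fin m)) : Set (ℕ → U₀) :=
  {u | ∀ t < S, (trajectory f y₀ u t, u t) ∈ G Y U f}

/-- The optimal discounted value `V_α(y₀)` for a bounded cost `g` and `0 < α < 1`
(the series then converges absolutely for every control). -/
def discountedValue (Y : Set (EuclideanSpace ℝ (Fin m)))
    (U : EuclideanSpace ℝ (Fin m) → Set U₀)
    (f : EuclideanSpace ℝ (Fin m) × U₀ → EuclideanSpace ℝ (Fin m))
    (g : EuclideanSpace ℝ (Fin m) × U₀ → ℝ)
    (α : ℝ) (y₀ : EuclideanSpace ℝ (Fin m)) : EReal :=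
  ⨅ u ∈ admissibleControls Y U f y₀,
    (((1 - α) * ∑' t : ℕ, α ^ t * g (trajectory f y₀ u t, u t) : ℝ) : EReal)

/-- The optimal averaged value `V(S, y₀)` for `S ≥ 1`. -/
def averageValue (Y : Set (EuclideanSpace ℝ (Fin m)))
    (U : EuclideanSpace ℝ (Fin m) → Set U₀)
    (f : EuclideanSpace ℝ (Fin m) × U₀ → EuclideanSpace ℝ (Fin m))
    (g : EuclideanSpace ℝ (Fin m) × U₀ → ℝ)
    (S : ℕ) (y₀ : EuclideanSpace ℝ (Fin m)) : EReal :=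
  ⨅ u ∈ admissibleControlsUpTo Y U f S y₀,
    ((1 / (S : ℝ) * ∑ t ∈ Finset.range S, g (trajectory f y₀ u t, u t) : ℝ) : EReal)

/-- The state `y ∈ Y` of a point `(y, u) ∈ G`. -/
def currentState (Y : Set (EuclideanSpace ℝ (Fin m)))
    (U : EuclideanSpace ℝ (Fin m) → Set U₀)
    (f : EuclideanSpace ℝ (Fin m) × U₀ → EuclideanSpace ℝ (Fin m)) (p : G Y U f) : Y :=
  ⟨p.1.1, p.2.1⟩

/-- The next state `f(y, u) ∈ Y` of a point `(y, u) ∈ G`. -/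
def nextState (Y : Set (EuclideanSpace ℝ (Fin m)))
    (U : EuclideanSpace ℝ (Fin m) → Set U₀)
    (f : EuclideanSpace ℝ (Fin m) × U₀ → EuclideanSpace ℝ (Fin m)) (p : G Y U f) : Y :=
  ⟨f p.1, p.2.2.2⟩

/-- The set `W` of the probability measures `γ` on the Borel subsets of `G` such that
`∫_G (φ(f(y,u)) - φ(y)) dγ = 0` for all continuous `φ` on the one-point compactification of `Y`. -/
def W [MeasurableSpace U₀] (Y : Set (EuclideanSpace ℝ (Fin m)))
    (U : EuclideanSpace ℝ (Fin m) → Set U₀)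
    (f : EuclideanSpace ℝ (Fin m) × U₀ → EuclideanSpace ℝ (Fin m)) :
    Set (ProbabilityMeasure (G Y U f)) :=
  {γ | ∀ φ : C(OnePoint Y, ℝ),
    ∫ p : G Y U f, (φ ((nextState Y U f p : Y) : OnePoint Y)
      - φ ((currentState Y U f p : Y) : OnePoint Y)) ∂(γ : Measure (G Y U f)) = 0}

/-- The optimal value `g* = inf_{γ ∈ W} ∫_G g dγ` for a bounded continuous cost `g`
(equal to `+∞` if `W` is empty). -/
def gStar [MeasurableSpace U₀] (Y : Set (EuclideanSpace ℝ (Fin m)))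
    (U : EuclideanSpace ℝ (Fin m) → Set U₀)
    (f : EuclideanSpace ℝ (Fin m) × U₀ → EuclideanSpace ℝ (Fin m))
    (g : EuclideanSpace ℝ (Fin m) × U₀ → ℝ) : EReal :=
  ⨅ γ ∈ W Y U f, ((∫ p : G Y U f, g p.1 ∂(γ : Measure (G Y U f)) : ℝ) : EReal)

end ControlLP

end

/-!
Fix summable weights `w` with sum one and let `F_w(y)` be the optimal value of the weighted
cost `∑ w t * g (y t, u t)` over the controls admissible from `y` on the infinite horizon. Both
optimal values in the theorem are controlled by functions of this kind: the discounted value has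
the weights `(1 - α) α ^ t`, and the averaged value over `S` steps is at most `F_w` for the weights
`1 / S` on `{0, …, S - 1}`, because a control admissible on the infinite horizon is admissible up
to time `S`. It therefore suffices that some `y ∈ Y` satisfies `F_w(y) ≤ ∫ g dγ`, for every `γ ∈ W`.

Controls range over the compact space `ℕ → U₀` and the admissible processes form a closed set
(`isClosed_admissible`, where upper hemicontinuity of `U` is used). So `F_w` is attained and
lower semicontinuous, in particular measurable. Prepending a first step to an optimal
control gives the dynamic programming inequality
`F_w(y) ≤ w 0 * g (y, u) + F_{w(· + 1)}(f (y, u))` on `G` (`weightedValue_le_add`).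

The constraint defining `W` says that `y` and `f (y, u)` have the same law under `γ`
(`map_nextState_eq_map_currentState`). Integrating the inequality against `γ` and iterating it
`N` times bounds `∫ F_w dγ` by `(∑ t < N, w t) ∫ g dγ` plus the integral of `F_{w(· + N)}`, which
tends to `0` because `g` is bounded. Hence `∫ F_w dγ ≤ ∫ g dγ` (`integral_weightedValue_le`), and
`F_w` is at most its mean at some point (`exists_weightedCost_le`).
-/

namespace ControlLP

variable {m : ℕ} {U₀ : Type*}

/-! ### Trajectories and admissible controls -/

section Trajectories

variable {Y : Set (EuclideanSpace ℝ (Fin m))} {U : EuclideanSpace ℝ (Fin m) → Set U₀}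
  {f : EuclideanSpace ℝ (Fin m) × U₀ → EuclideanSpace ℝ (Fin m)}

/-- The control that plays `u` at time `0` and then follows `v` with a delay of one step. -/
def prependControl (u : U₀) (v : ℕ → U₀) : ℕ → U₀
  | 0 => u
  | t + 1 => v t

theorem trajectory_prependControl_succ (y : EuclideanSpace ℝ (Fin m)) (u : U₀) (v : ℕ → U₀)
    (t : ℕ) :
    trajectory f y (prependControl u v) (t + 1) = trajectory f (f (y, u)) v t := by
  induction t with
  | zero => rfl
  | succ t ih => rw [trajectory, ih]; rfl

theorem prependControl_mem_admissibleControls {y : EuclideanSpace ℝ (Fin m)} {u : U₀}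
    {v : ℕ → U₀} (hy : y ∈ Y) (hu : u ∈ U y) (hv : v ∈ admissibleControls Y U f (f (y, u))) :
    prependControl u v ∈ admissibleControls Y U f y := by
  intro t
  cases t with
  | zero => exact ⟨hy, hu⟩
  | succ t =>
    rw [trajectory_prependControl_succ]
    exact hv t

theorem admissibleControls_subset_admissibleControlsUpTo (S : ℕ)
    (y : EuclideanSpace ℝ (Fin m)) :
    admissibleControls Y U f y ⊆ admissibleControlsUpTo Y U f S y :=
  fun _ hu t _ => ⟨(hu t).1, (hu t).2, (hu (t + 1)).1⟩

variable [TopologicalSpace U₀]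

theorem continuous_trajectory (hf : Continuous f) (t : ℕ) :
    Continuous fun q : EuclideanSpace ℝ (Fin m) × (ℕ → U₀) => trajectory f q.1 q.2 t := by
  induction t with
  | zero => exact continuous_fst
  | succ t ih => exact hf.comp (ih.prodMk ((continuous_apply t).comp continuous_snd))

/-- An upper hemicontinuous map with closed values on a closed set has a closed graph. -/
theorem isClosed_graph [RegularSpace U₀] (hY : IsClosed Y) (hU : UpperHemicontinuousOn U Y)
    (hUc : ∀ y ∈ Y, IsClosed (U y)) :
    IsClosed {p : EuclideanSpace ℝ (Fin m) × U₀ | p.1 ∈ Y ∧ p.2 ∈ U p.1} := by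
  rw [isClosed_iff_frequently]
  rintro ⟨y, u⟩ hyu
  have hy : y ∈ Y := by
    refine isClosed_iff_frequently.1 hY y ?_
    exact (continuous_fst.tendsto (y, u)).frequently (hyu.mono fun p hp => hp.1)
  refine ⟨hy, ?_⟩
  rw [← (hUc y hy).closure_eq]
  refine mem_closure_iff_nhds.2 fun s hs => ?_
  obtain ⟨C, ⟨hCu, hC⟩, hCs⟩ := (closed_nhds_basis u).mem_iff.1 hs
  have hfreq : ∃ᶠ y' in 𝓝[Y] y, (U y' ∩ C).Nonempty := by
    rw [frequently_nhdsWithin_iff]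
    refine (continuous_fst.tendsto (y, u)).frequently ?_
    refine (hyu.and_eventually ((continuous_snd.tendsto (y, u)).eventually hCu)).mono ?_
    rintro p ⟨⟨hpY, hpU⟩, hpC⟩
    exact ⟨⟨p.2, hpU, hpC⟩, hpY⟩
  obtain ⟨v, hvU, hvC⟩ := upperHemicontinuousOn_iff_frequently.1 hU y hy C hC hfreq
  exact ⟨v, hCs hvC, hvU⟩

/-- The admissible processes form a closed set of pairs (initial state, control). -/
theorem isClosed_admissible [RegularSpace U₀] (hY : IsClosed Y) (hU : UpperHemicontinuousOn U Y)
    (hUc : ∀ y ∈ Y, IsClosed (U y)) (hf : Continuous f) :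
    IsClosed {q : EuclideanSpace ℝ (Fin m) × (ℕ → U₀) | q.2 ∈ admissibleControls Y U f q.1} := by
  have h : {q : EuclideanSpace ℝ (Fin m) × (ℕ → U₀) | q.2 ∈ admissibleControls Y U f q.1} =
      ⋂ t, (fun q => (trajectory f q.1 q.2 t, q.2 t)) ⁻¹' {p | p.1 ∈ Y ∧ p.2 ∈ U p.1} := by
    ext q
    simp [admissibleControls]
  rw [h]
  exact isClosed_iInter fun t => (isClosed_graph hY hU hUc).preimage
    ((continuous_trajectory hf t).prodMk ((continuous_apply t).comp continuous_snd))

end Trajectories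

/-! ### Weighted costs and their optimal values -/

section WeightedCost

variable (Y : Set (EuclideanSpace ℝ (Fin m))) (U : EuclideanSpace ℝ (Fin m) → Set U₀)
  (f : EuclideanSpace ℝ (Fin m) × U₀ → EuclideanSpace ℝ (Fin m))
  (g : EuclideanSpace ℝ (Fin m) × U₀ → ℝ)

/-- The cost of a control when the stage cost at time `t` carries the weight `w t`. -/
noncomputable def weightedCost (w : ℕ → ℝ) (y : EuclideanSpace ℝ (Fin m)) (u : ℕ → U₀) : ℝ :=
  ∑' t, w t * g (trajectory f y u t, u t)

/-- The optimal weighted cost over the controls admissible on the infinite horizon. It is a genuine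
infimum for summable `w`, bounded `g` and states with an admissible control, and is `0` at states
without one. -/
noncomputable def weightedValue (w : ℕ → ℝ) (y : EuclideanSpace ℝ (Fin m)) : ℝ :=
  sInf (weightedCost f g w y '' admissibleControls Y U f y)

variable {Y U f g} {w : ℕ → ℝ} {M : ℝ}

theorem norm_weight_mul_le (hM : ∀ p, |g p| ≤ M) (t : ℕ)
    (p : EuclideanSpace ℝ (Fin m) × U₀) : ‖w t * g p‖ ≤ |w t| * M := by
  rw [norm_mul]
  exact mul_le_mul_of_nonneg_left (hM p) (abs_nonneg _)

theorem summable_weightedCost (hw : Summable w) (hM : ∀ p, |g p| ≤ M)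
    (y : EuclideanSpace ℝ (Fin m)) (u : ℕ → U₀) :
    Summable fun t => w t * g (trajectory f y u t, u t) :=
  .of_norm_bounded (hw.abs.mul_right M) fun t => norm_weight_mul_le hM t _

theorem abs_weightedCost_le (hw : Summable w) (hM : ∀ p, |g p| ≤ M)
    (y : EuclideanSpace ℝ (Fin m)) (u : ℕ → U₀) :
    |weightedCost f g w y u| ≤ (∑' t, |w t|) * M :=
  tsum_of_norm_bounded (hw.abs.hasSum.mul_right M) fun t => norm_weight_mul_le hM t _

theorem weightedCost_prependControl (hw : Summable w) (hM : ∀ p, |g p| ≤ M)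
    (y : EuclideanSpace ℝ (Fin m)) (u : U₀) (v : ℕ → U₀) :
    weightedCost f g w y (prependControl u v) =
      w 0 * g (y, u) + weightedCost f g (fun t => w (t + 1)) (f (y, u)) v := by
  rw [weightedCost, (summable_weightedCost hw hM _ _).tsum_eq_zero_add]
  simp only [trajectory_prependControl_succ]
  rfl

theorem weightedValue_le (hw : Summable w) (hM : ∀ p, |g p| ≤ M)
    {y : EuclideanSpace ℝ (Fin m)} {u : ℕ → U₀} (hu : u ∈ admissibleControls Y U f y) :
    weightedValue Y U f g w y ≤ weightedCost f g w y u := by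
  refine csInf_le ⟨-((∑' t, |w t|) * M), ?_⟩ ⟨u, hu, rfl⟩
  rintro _ ⟨v, -, rfl⟩
  exact neg_le_of_abs_le (abs_weightedCost_le hw hM y v)

variable [TopologicalSpace U₀]

theorem continuous_weightedCost (hf : Continuous f) (hg : Continuous g) (hw : Summable w)
    (hM : ∀ p, |g p| ≤ M) :
    Continuous fun q : EuclideanSpace ℝ (Fin m) × (ℕ → U₀) => weightedCost f g w q.1 q.2 :=
  continuous_tsum
    (fun t => continuous_const.mul (hg.comp
      ((continuous_trajectory hf t).prodMk ((continuous_apply t).comp continuous_snd))))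
    (hw.abs.mul_right M) fun t _ => norm_weight_mul_le hM t _

variable [CompactSpace U₀] [RegularSpace U₀]

/-- Optimal controls exist, since the admissible controls from `y` form a compact set. -/
theorem exists_weightedCost_eq_weightedValue (hY : IsClosed Y) (hU : UpperHemicontinuousOn U Y)
    (hUc : ∀ y ∈ Y, IsClosed (U y)) (hf : Continuous f) (hg : Continuous g) (hw : Summable w)
    (hM : ∀ p, |g p| ≤ M) {y : EuclideanSpace ℝ (Fin m)}
    (hne : (admissibleControls Y U f y).Nonempty) :
    ∃ u ∈ admissibleControls Y U f y, weightedCost f g w y u = weightedValue Y U f g w y := by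
  have hc : IsCompact (admissibleControls Y U f y) :=
    ((isClosed_admissible hY hU hUc hf).preimage (Continuous.prodMk_right y)).isCompact
  have hcont : Continuous (weightedCost f g w y) :=
    (continuous_weightedCost hf hg hw hM).comp (Continuous.prodMk_right y)
  exact (hc.image hcont).sInf_mem (hne.image _)

/-- The sublevel sets of the value are projections of closed sets along a compact factor. -/
theorem lowerSemicontinuous_weightedValue (hY : IsClosed Y) (hU : UpperHemicontinuousOn U Y)
    (hUc : ∀ y ∈ Y, IsClosed (U y)) (hf : Continuous f) (hg : Continuous g) (hw : Summable w)
    (hM : ∀ p, |g p| ≤ M) (hne : ∀ y ∈ Y, (admissibleControls Y U f y).Nonempty) :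
    LowerSemicontinuous fun y : Y => weightedValue Y U f g w y := by
  rw [lowerSemicontinuous_iff_isClosed_preimage]
  intro c
  have hproj := isClosedMap_fst_of_compactSpace _ ((isClosed_admissible hY hU hUc hf).inter
    (isClosed_le (continuous_weightedCost hf hg hw hM) (continuous_const (y := c))))
  convert hproj.preimage (continuous_subtype_val (p := (· ∈ Y))) using 1
  ext y
  constructor
  · intro h
    obtain ⟨u, hu, hval⟩ :=
      exists_weightedCost_eq_weightedValue hY hU hUc hf hg hw hM (hne y y.2)
    exact ⟨(y, u), ⟨hu, hval.le.trans h⟩, rfl⟩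
  · rintro ⟨⟨_, u⟩, ⟨hu, hle⟩, rfl⟩
    exact (weightedValue_le hw hM hu).trans hle

theorem abs_weightedValue_le (hY : IsClosed Y) (hU : UpperHemicontinuousOn U Y)
    (hUc : ∀ y ∈ Y, IsClosed (U y)) (hf : Continuous f) (hg : Continuous g) (hw : Summable w)
    (hM : ∀ p, |g p| ≤ M) {y : EuclideanSpace ℝ (Fin m)}
    (hne : (admissibleControls Y U f y).Nonempty) :
    |weightedValue Y U f g w y| ≤ (∑' t, |w t|) * M := by
  obtain ⟨u, -, hval⟩ := exists_weightedCost_eq_weightedValue hY hU hUc hf hg hw hM hne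
  rw [← hval]
  exact abs_weightedCost_le hw hM y u

/-- The dynamic programming inequality: playing `u` first and continuing optimally is admissible. -/
theorem weightedValue_le_add (hY : IsClosed Y) (hU : UpperHemicontinuousOn U Y)
    (hUc : ∀ y ∈ Y, IsClosed (U y)) (hf : Continuous f) (hg : Continuous g) (hw : Summable w)
    (hM : ∀ p, |g p| ≤ M) (hne : ∀ y ∈ Y, (admissibleControls Y U f y).Nonempty)
    {p : EuclideanSpace ℝ (Fin m) × U₀} (hp : p ∈ G Y U f) :
    weightedValue Y U f g w p.1 ≤
      w 0 * g p + weightedValue Y U f g (fun t => w (t + 1)) (f p) := by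
  obtain ⟨v, hv, hval⟩ := exists_weightedCost_eq_weightedValue hY hU hUc hf hg
    ((summable_nat_add_iff 1).2 hw) hM (hne (f p) hp.2.2)
  rw [← hval, ← weightedCost_prependControl hw hM p.1 p.2 v]
  exact weightedValue_le hw hM (prependControl_mem_admissibleControls hp.1 hp.2.1 hv)

end WeightedCost

/-! ### Integration against stationary measures -/

section Stationarity

variable {Y : Set (EuclideanSpace ℝ (Fin m))} {U : EuclideanSpace ℝ (Fin m) → Set U₀}
  {f : EuclideanSpace ℝ (Fin m) × U₀ → EuclideanSpace ℝ (Fin m)}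
  {g : EuclideanSpace ℝ (Fin m) × U₀ → ℝ} {w : ℕ → ℝ} {M : ℝ}

section

variable [TopologicalSpace U₀]

theorem continuous_currentState : Continuous (currentState Y U f) :=
  (continuous_fst.comp continuous_subtype_val).subtype_mk _

theorem continuous_nextState (hf : Continuous f) : Continuous (nextState Y U f) :=
  (hf.comp continuous_subtype_val).subtype_mk _

theorem integrable_weightedValue_comp [CompactSpace U₀] [RegularSpace U₀] [MeasurableSpace U₀]
    (hY : IsClosed Y) (hU : UpperHemicontinuousOn U Y) (hUc : ∀ y ∈ Y, IsClosed (U y))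
    (hf : Continuous f) (hg : Continuous g) (hw : Summable w) (hM : ∀ p, |g p| ≤ M)
    (hne : ∀ y ∈ Y, (admissibleControls Y U f y).Nonempty)
    (γ : ProbabilityMeasure (G Y U f)) {s : G Y U f → Y} (hs : Measurable s) :
    Integrable (fun p => weightedValue Y U f g w (s p)) (γ : Measure (G Y U f)) :=
  .of_bound ((lowerSemicontinuous_weightedValue hY hU hUc hf hg hw hM
      hne).measurable.comp hs).aestronglyMeasurable _
    (ae_of_all _ fun p => abs_weightedValue_le hY hU hUc hf hg hw hM (hne _ (s p).2))

end

variable [TopologicalSpace U₀] [MeasurableSpace U₀] [BorelSpace U₀]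

/-- Under a measure in `W` the current and the next state have the same law: the test functions
in `W` include the extensions by zero of all compactly supported continuous functions on `Y`. -/
theorem map_nextState_eq_map_currentState (hY : IsClosed Y) (hf : Continuous f)
    {γ : ProbabilityMeasure (G Y U f)} (hγ : γ ∈ W Y U f) :
    (γ : Measure (G Y U f)).map (nextState Y U f) =
      (γ : Measure (G Y U f)).map (currentState Y U f) := by
  have : LocallyCompactSpace Y := hY.locallyCompactSpace
  have hn : Measurable (nextState Y U f) := (continuous_nextState hf).measurable
  have hc : Measurable (currentState Y U f) := continuous_currentState.measurable
  have := Measure.isProbabilityMeasure_map (μ := (γ : Measure (G Y U f))) hn.aemeasurable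
  have := Measure.isProbabilityMeasure_map (μ := (γ : Measure (G Y U f))) hc.aemeasurable
  refine Measure.ext_of_integral_eq_on_compactlySupported fun φ => ?_
  have hφ : Tendsto φ (coclosedCompact Y) (𝓝 0) := by
    rw [coclosedCompact_eq_cocompact]
    exact φ.hasCompactSupport.is_zero_at_infty
  have key := hγ (OnePoint.continuousMapMk φ.toContinuousMap 0 hφ)
  have hint : ∀ s : G Y U f → Y, Measurable s → Integrable (fun p => φ (s p))
      (γ : Measure (G Y U f)) := fun s hs =>
    (φ.integrable (μ := (γ : Measure (G Y U f)).map s)).comp_measurable hs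
  rw [integral_map hn.aemeasurable (map_continuous φ).aestronglyMeasurable,
    integral_map hc.aemeasurable (map_continuous φ).aestronglyMeasurable, ← sub_eq_zero,
    ← integral_sub (hint _ hn) (hint _ hc)]
  exact key

theorem integrable_cost (hg : Continuous g) (hM : ∀ p, |g p| ≤ M)
    (γ : ProbabilityMeasure (G Y U f)) :
    Integrable (fun p : G Y U f => g p.1) (γ : Measure (G Y U f)) :=
  .of_bound (hg.comp continuous_subtype_val).measurable.aestronglyMeasurable M
    (ae_of_all _ fun p => hM p.1)

variable [CompactSpace U₀] [RegularSpace U₀]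

/-- The integrated dynamic programming inequality, iterated `N` times. -/
theorem integral_weightedValue_le_add (hY : IsClosed Y) (hU : UpperHemicontinuousOn U Y)
    (hUc : ∀ y ∈ Y, IsClosed (U y)) (hf : Continuous f) (hg : Continuous g)
    (hM : ∀ p, |g p| ≤ M) (hne : ∀ y ∈ Y, (admissibleControls Y U f y).Nonempty)
    {γ : ProbabilityMeasure (G Y U f)} (hγ : γ ∈ W Y U f) (N : ℕ) :
    ∀ {w : ℕ → ℝ}, Summable w →
    ∫ p : G Y U f, weightedValue Y U f g w (currentState Y U f p) ∂(γ : Measure (G Y U f)) ≤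
      (∑ t ∈ Finset.range N, w t) * ∫ p : G Y U f, g p.1 ∂(γ : Measure (G Y U f)) +
      ∫ p : G Y U f, weightedValue Y U f g (fun t => w (t + N)) (currentState Y U f p)
        ∂(γ : Measure (G Y U f)) := by
  have hn : Measurable (nextState Y U f) := (continuous_nextState hf).measurable
  have hc : Measurable (currentState Y U f) := continuous_currentState.measurable
  induction N with
  | zero => intro w _; simp
  | succ N ih =>
    intro w hw
    have hw' : Summable fun t => w (t + N) := (summable_nat_add_iff N).2 hw
    have hw'' : Summable fun t => w (t + 1 + N) := (summable_nat_add_iff 1).2 hw'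
    have hmeas : Measurable fun y : Y => weightedValue Y U f g (fun t => w (t + 1 + N)) y :=
      (lowerSemicontinuous_weightedValue hY hU hUc hf hg hw'' hM hne).measurable
    have hstat :
        ∫ p : G Y U f, weightedValue Y U f g (fun t => w (t + 1 + N)) (nextState Y U f p)
          ∂(γ : Measure (G Y U f)) =
        ∫ p : G Y U f, weightedValue Y U f g (fun t => w (t + 1 + N)) (currentState Y U f p)
          ∂(γ : Measure (G Y U f)) := by
      rw [← integral_map hn.aemeasurable hmeas.aestronglyMeasurable,
        ← integral_map hc.aemeasurable hmeas.aestronglyMeasurable,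
        map_nextState_eq_map_currentState hY hf hγ]
    have hstep := integral_mono (integrable_weightedValue_comp hY hU hUc hf hg hw' hM hne γ hc)
      (((integrable_cost hg hM γ).const_mul (w (0 + N))).add
        (integrable_weightedValue_comp hY hU hUc hf hg hw'' hM hne γ hn))
      fun p => weightedValue_le_add hY hU hUc hf hg hw' hM hne p.2
    simp only [Pi.add_apply] at hstep
    rw [integral_add ((integrable_cost hg hM γ).const_mul _)
      (integrable_weightedValue_comp hY hU hUc hf hg hw'' hM hne γ hn), integral_const_mul,
      hstat, zero_add] at hstep
    have hshift : (fun t => w (t + (N + 1))) = fun t => w (t + 1 + N) := by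
      funext t
      rw [add_right_comm, add_assoc]
    rw [Finset.sum_range_succ, add_mul, hshift]
    linarith [ih hw]

/-- Integrated against a measure in `W`, the value is at most the total weight times the mean
stage cost. -/
theorem integral_weightedValue_le (hY : IsClosed Y) (hU : UpperHemicontinuousOn U Y)
    (hUc : ∀ y ∈ Y, IsClosed (U y)) (hf : Continuous f) (hg : Continuous g) (hw : Summable w)
    (hM : ∀ p, |g p| ≤ M) (hne : ∀ y ∈ Y, (admissibleControls Y U f y).Nonempty)
    {γ : ProbabilityMeasure (G Y U f)} (hγ : γ ∈ W Y U f) :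
    ∫ p : G Y U f, weightedValue Y U f g w (currentState Y U f p) ∂(γ : Measure (G Y U f)) ≤
      (∑' t, w t) * ∫ p : G Y U f, g p.1 ∂(γ : Measure (G Y U f)) := by
  have hlim : Tendsto (fun N => (∑ t ∈ Finset.range N, w t) *
      ∫ p : G Y U f, g p.1 ∂(γ : Measure (G Y U f)) + (∑' t, |w (t + N)|) * M) atTop
      (𝓝 ((∑' t, w t) * ∫ p : G Y U f, g p.1 ∂(γ : Measure (G Y U f)) + 0 * M)) :=
    (hw.hasSum.tendsto_sum_nat.mul_const _).add
      ((tendsto_sum_nat_add fun t => |w t|).mul_const M)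
  rw [zero_mul, add_zero] at hlim
  refine ge_of_tendsto' hlim fun N => ?_
  refine (integral_weightedValue_le_add hY hU hUc hf hg hM hne hγ N hw).trans ?_
  have hwN : Summable fun t => w (t + N) := (summable_nat_add_iff N).2 hw
  refine add_le_add le_rfl ((integral_mono
    (integrable_weightedValue_comp hY hU hUc hf hg hwN hM hne γ
      continuous_currentState.measurable) (integrable_const _) fun p =>
        le_of_abs_le (abs_weightedValue_le hY hU hUc hf hg hwN hM (hne _ p.2.1))).trans ?_)
  simp

/-- For weights with sum one, some admissible process costs at most the mean stage cost. -/
theorem exists_weightedCost_le (hY : IsClosed Y) (hU : UpperHemicontinuousOn U Y)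
    (hUc : ∀ y ∈ Y, IsClosed (U y)) (hf : Continuous f) (hg : Continuous g) (hw : HasSum w 1)
    (hM : ∀ p, |g p| ≤ M) (hne : ∀ y ∈ Y, (admissibleControls Y U f y).Nonempty)
    {γ : ProbabilityMeasure (G Y U f)} (hγ : γ ∈ W Y U f) :
    ∃ y ∈ Y, ∃ u ∈ admissibleControls Y U f y,
      weightedCost f g w y u ≤ ∫ p : G Y U f, g p.1 ∂(γ : Measure (G Y U f)) := by
  obtain ⟨p, hp⟩ := exists_le_integral (integrable_weightedValue_comp hY hU hUc hf hg hw.summable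
    hM hne γ continuous_currentState.measurable)
  have hle := integral_weightedValue_le hY hU hUc hf hg hw.summable hM hne hγ
  rw [hw.tsum_eq, one_mul] at hle
  obtain ⟨u, hu, hval⟩ := exists_weightedCost_eq_weightedValue hY hU hUc hf hg hw.summable hM
    (hne _ p.2.1)
  exact ⟨p.1.1, p.2.1, u, hu, hval.le.trans (hp.trans hle)⟩

end Stationarity

end ControlLP

/-! ### Discounted and averaged values -/

theorem proposition5p2 {m : ℕ} {U₀ : Type*} [MetricSpace U₀] [CompactSpace U₀]
    [MeasurableSpace U₀] [BorelSpace U₀]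
    (Y : Set (EuclideanSpace ℝ (Fin m))) (hY_closed : IsClosed Y) (hY_unbdd : ¬ IsBounded Y)
    (U : EuclideanSpace ℝ (Fin m) → Set U₀)
    (hU_usc : UpperHemicontinuousOn U Y) (hU_compact : ∀ y ∈ Y, IsCompact (U y))
    (f : EuclideanSpace ℝ (Fin m) × U₀ → EuclideanSpace ℝ (Fin m)) (hf : Continuous f)
    (hf_inf : ∀ R : ℝ, ∃ r : ℝ, ∀ (y : EuclideanSpace ℝ (Fin m)) (u : U₀),
      r ≤ ‖y‖ → R ≤ ‖f (y, u)‖)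
    (hviable : ∀ y₀ ∈ Y, (ControlLP.admissibleControls Y U f y₀).Nonempty)
    (g : EuclideanSpace ℝ (Fin m) × U₀ → ℝ) (hg : Continuous g)
    (hg_bdd : ∃ M : ℝ, ∀ p, |g p| ≤ M) :
    limsup (fun α : ℝ => ⨅ y ∈ Y, ControlLP.discountedValue Y U f g α y) (𝓝[<] 1)
        ≤ ControlLP.gStar Y U f g ∧
      limsup (fun S : ℕ => ⨅ y ∈ Y, ControlLP.averageValue Y U f g S y) atTop
        ≤ ControlLP.gStar Y U f g := by
  obtain ⟨M, hM⟩ := hg_bdd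
  have hUc : ∀ y ∈ Y, IsClosed (U y) := fun y hy => (hU_compact y hy).isClosed
  refine ⟨le_iInf₂ fun γ hγ => limsup_le_of_le (h := ?_),
    le_iInf₂ fun γ hγ => limsup_le_of_le (h := ?_)⟩
  · filter_upwards [Ioo_mem_nhdsLT (zero_lt_one (α := ℝ))] with α hα
    have hw : HasSum (fun t : ℕ => (1 - α) * α ^ t) 1 := by
      have h := (hasSum_geometric_of_lt_one hα.1.le hα.2).mul_left (1 - α)
      rwa [mul_inv_cancel₀ (sub_pos.2 hα.2).ne'] at h
    obtain ⟨y, hy, u, hu, hle⟩ :=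
      ControlLP.exists_weightedCost_le hY_closed hU_usc hUc hf hg hw hM hviable hγ
    refine (iInf₂_le y hy).trans ((iInf₂_le u hu).trans (EReal.coe_le_coe_iff.2 ?_))
    simpa only [ControlLP.weightedCost, mul_assoc, tsum_mul_left] using hle
  · filter_upwards [eventually_gt_atTop 0] with S hS
    have hsupp : ∀ t ∉ Finset.range S, (if t < S then 1 / (S : ℝ) else 0) = 0 := fun t ht =>
      if_neg (by simpa using ht)
    have hw : HasSum (fun t : ℕ => if t < S then 1 / (S : ℝ) else 0) 1 := by
      have h : HasSum (fun t : ℕ => if t < S then 1 / (S : ℝ) else 0) _ :=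
        hasSum_sum_of_ne_finset_zero hsupp
      rw [Finset.sum_congr rfl fun t ht => if_pos (Finset.mem_range.1 ht)] at h
      simpa [hS.ne'] using h
    obtain ⟨y, hy, u, hu, hle⟩ :=
      ControlLP.exists_weightedCost_le hY_closed hU_usc hUc hf hg hw hM hviable hγ
    refine (iInf₂_le y hy).trans ((iInf₂_le u
      (ControlLP.admissibleControls_subset_admissibleControlsUpTo S y hu)).trans
        (EReal.coe_le_coe_iff.2 ?_))
    convert! hle using 1
    rw [ControlLP.weightedCost, tsum_eq_sum fun t ht => by rw [hsupp t ht, zero_mul],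
      Finset.mul_sum]
    exact Finset.sum_congr rfl fun t ht => by rw [if_pos (Finset.mem_range.1 ht)]
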